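/- **Setting.** Points live in $\mathbb{R}^D$ with the Euclidean norm, $m>1$ is real, $K\ge 1$ is an integer. For a finite set $Y\subset\mathbb{R}^D$, weights $w:Y\to\mathbb{R}_{\ge 0}$ and a finite non-empty set $M\subset\mathbb{R}^D$ let \[ \mathrm{km}(Y,w,M)=\sum_{x\in Y}w(x)\,\min_{\mu\in M}\|x-\mu\|^2,\qquad \phi(Y,w,M)=\min_r\sum_{x\in Y}w(x)\sum_{\mu\in M}r(x,\mu)^m\|x-\mu\|^2, \] where $r$ ranges over all $r:Y\times M\to[0,1]$ with $\sum_{\mu\in M}r(x,\mu)=1$ for all $x\in Y$. Write $\mathbf 1$ for the weight function that is constantly $1$. **Input.** Let $X\subset\mathbb{R}^D$ be a finite set with $N=|X|$, let $\gamma\ge1$ be an integer, $\alpha,\beta\ge1$ real with $\alpha N>1$, $\varepsilon,\delta\in(0,1)$, and let $A\subset\mathbb{R}^D$ be a finite non-empty $(\alpha,\beta)$-bicriteria approximation of $K$-means on $X$, i.e. $|A|\le\beta K$ and $\mathrm{km}(X,\mathbf 1,A)\le\alpha\min_{1\le|M|\le K}\mathrm{km}(X,\mathbf 1,M)$. Let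 $(A_a)_{a\in A}$ be a partition of $X$ obtained by assigning each point of $X$ to a closest point of $A$, ties being broken arbitrarily. Put \[ F=\left\lceil\tfrac12\log_2(\alpha N)\right\rceil,\quad R=\sqrt{\frac{\mathrm{km}(X,\mathbf 1,A)}{\alpha N}},\quad q=\left\lceil\mathbf q\left(\frac{\alpha K^{m-1}}{\varepsilon}\right)^2\ln\left(\frac{4\beta KF\gamma^K}{\delta}\right)\right\rceil . \] For $a\in A$ let $X_{a,0}$ be the set of all $x\in A_a$ with $\|x-a\|\le R$, and for $1\le j\le F$ let $X_{a,j}$ be the set of all $x\in A_a$ with $2^{j-1}R<\|x-a\|\le 2^jR$. **Sampling.** From each non-empty $X_{a,j}$ draw $q$ points independently and uniformly at random (with replacement, all draws being independent). Let $S$ be the set of all drawn points; each time a point is drawn from $X_{a,j}$, its weight $w_S$ (initially $0$) increases by $|X_{a,j}|/q$. **Integer variant.** From each $X_{a,j}$ first set aside an arbitrary (fixed) subset of $|X_{a,j}|\bmod q$ points, and let $X'_{a,j}$ be the set of the other points. Make the $q$ draws from $X'_{a,j}$ whenever it is non-empty, each draw increasing the weight of the drawn point by the integer $|X'_{a,j}|/q$.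 Let $S$ consist of all drawn points and all points set aside, the latter with weight $1$. **Lemma.** There is a universal constant $\mathbf q_0>0$ such that for every constant $\mathbf q\ge\mathbf q_0$, every input as above, and every $\Gamma\subset\mathbb{R}^D$ with $|\Gamma|\le\gamma$, the following holds for the output $(S,w_S)$ of the sampling algorithm as well as for that of its integer variant (for every choice of the points set aside). Always $S\subseteq X$, all weights $w_S(s)$, $s \in S$, are positive, and $\sum_{s\in S}w_S(s)=N$; in the integer variant all weights are natural numbers. With probability at least $1-\delta$, simultaneously for all non-empty $M\subseteq\Gamma$ with $|M|\le K$, \[ (1-\varepsilon)\,\phi(X,\mathbf 1,M)\le\phi(S,w_S,M)\le(1+\varepsilon)\,\phi(X,\mathbf 1,M), \] \[ \left(1-\frac{\varepsilon}{K^{m-1}}\right)\mathrm{km}(X,\mathbf 1,M)\le\mathrm{km}(S,w_S,M)\le\left(1+\frac{\varepsilon}{K^{m-1}}\right)\mathrm{km}(X,\mathbf 1,M). \] -/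

import Mathlib

open scoped Classical

noncomputable section

namespace FuzzyKMeans

/-- Points of `ℝ^D` with the Euclidean norm. -/
abbrev Pt (D : ℕ) : Type := EuclideanSpace ℝ (Fin D)

/-! ### Cost functions -/

/-- `km(X,w,M) = ∑_{x ∈ X} w(x) d(x,M)²`, where `d(x,M) = min_{μ ∈ M} ‖x - μ‖`
(used for finite non-empty `M` only). -/
def kmeansCost {D : ℕ} (X : Finset (Pt D)) (w : Pt D → ℝ) (M : Finset (Pt D)) : ℝ :=
  ∑ x ∈ X, w x * Metric.infDist x (M : Set (Pt D)) ^ 2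

/-- The optimal `K`-means cost, over all non-empty sets of at most `K` means. -/
def kmeansOpt {D : ℕ} (K : ℕ) (X : Finset (Pt D)) (w : Pt D → ℝ) : ℝ :=
  sInf {c : ℝ | ∃ M : Finset (Pt D), M.Nonempty ∧ M.card ≤ K ∧ c = kmeansCost X w M}

/-- `r` is a membership function of the points of `X` in the clusters given by the means in `M`. -/
def IsMembership {D : ℕ} (X M : Finset (Pt D)) (r : Pt D → Pt D → ℝ) : Prop :=
  ∀ x ∈ X, (∀ μ ∈ M, r x μ ∈ Set.Icc (0 : ℝ) 1) ∧ ∑ μ ∈ M, r x μ = 1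

/-- `φ(X,w,M,r)`, the fuzzy `K`-means cost with fuzzifier `m` of means `M` and memberships `r`. -/
def fuzzyCostWith {D : ℕ} (m : ℝ) (X : Finset (Pt D)) (w : Pt D → ℝ) (M : Finset (Pt D))
    (r : Pt D → Pt D → ℝ) : ℝ :=
  ∑ x ∈ X, w x * ∑ μ ∈ M, r x μ ^ m * ‖x - μ‖ ^ 2

/-- `φ(X,w,M)`, the fuzzy `K`-means cost of `M` with optimal memberships
(used for finite non-empty `M` and non-negative weights only). -/
def fuzzyCost {D : ℕ} (m : ℝ) (X : Finset (Pt D)) (w : Pt D → ℝ) (M : Finset (Pt D)) : ℝ :=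
  sInf {c : ℝ | ∃ r : Pt D → Pt D → ℝ, IsMembership X M r ∧ c = fuzzyCostWith m X w M r}

/-- `(S,w)` preserves, for all non-empty `M ⊆ Γ` with `|M| ≤ K`, the fuzzy `K`-means cost of the
unweighted set `X` up to a factor `1 ± ε` and its `K`-means cost up to a factor
`1 ± ε / K^(m-1)`. -/
def PreservesCosts {D : ℕ} (m ε : ℝ) (K : ℕ) (X Γ S : Finset (Pt D)) (w : Pt D → ℝ) : Prop :=
  ∀ M : Finset (Pt D), M ⊆ Γ → M.Nonempty → M.card ≤ K →
    fuzzyCost m S w M ∈ Set.Icc ((1 - ε) * fuzzyCost m X 1 M) ((1 + ε) * fuzzyCost m X 1 M) ∧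
    kmeansCost S w M ∈ Set.Icc ((1 - ε / (K : ℝ) ^ (m - 1)) * kmeansCost X 1 M)
      ((1 + ε / (K : ℝ) ^ (m - 1)) * kmeansCost X 1 M)

/-! ### Input of the sampling algorithm -/

/-- `A` is an `(α,β)`-bicriteria approximation of `K`-means on the unweighted set `X`. -/
def IsBicriteria {D : ℕ} (α β : ℝ) (K : ℕ) (X A : Finset (Pt D)) : Prop :=
  A.Nonempty ∧ (A.card : ℝ) ≤ β * K ∧ kmeansCost X 1 A ≤ α * kmeansOpt K X 1

/-- `c` assigns every point of `X` to a closest point of `A` (ties broken arbitrarily); the classes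
`{x ∈ X | c x = a}`, `a ∈ A`, are a partition of `X` induced by `A`. -/
def IsClosestAssignment {D : ℕ} (X A : Finset (Pt D)) (c : Pt D → Pt D) : Prop :=
  ∀ x ∈ X, c x ∈ A ∧ ∀ a ∈ A, ‖x - c x‖ ≤ ‖x - a‖

/-! ### Rings and parameters -/

/-- `F = ⌈(1/2) log₂ (α N)⌉`. -/
def ringCount (α : ℝ) (N : ℕ) : ℕ := ⌈(1 / 2) * Real.logb 2 (α * N)⌉₊

/-- `R = √(km(X,1,A) / (α N))`. -/
def baseRadius {D : ℕ} (α : ℝ) (X A : Finset (Pt D)) : ℝ :=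
  Real.sqrt (kmeansCost X 1 A / (α * X.card))

/-- `q = ⌈qc (α K^(m-1) / ε)² ln (4 β K F γ^K / δ)⌉`, for a constant `qc`. -/
def sampleSize (qc m α β ε δ : ℝ) (K γ F : ℕ) : ℕ :=
  ⌈qc * (α * (K : ℝ) ^ (m - 1) / ε) ^ 2 *
    Real.log (4 * β * K * F * (γ : ℝ) ^ K / δ)⌉₊

/-- The ring `L_j` around `a`: the closed ball of radius `R` for `j = 0`, and the closed ball of
radius `2^j R` minus the one of radius `2^(j-1) R` for `j ≥ 1`. -/
def ring {D : ℕ} (R : ℝ) (a : Pt D) (j : ℕ) : Set (Pt D) :=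
  if j = 0 then Metric.closedBall a R
  else Metric.closedBall a (2 ^ j * R) \ Metric.closedBall a (2 ^ (j - 1) * R)

/-- The cell `X_{a,j}`: points of `X` assigned to `a` that lie in the `j`-th ring around `a`. -/
def cell {D : ℕ} (X : Finset (Pt D)) (c : Pt D → Pt D) (R : ℝ) (p : Pt D × ℕ) :
    Finset (Pt D) :=
  X.filter fun x => c x = p.1 ∧ x ∈ ring R p.1 p.2

/-- Indices `(a,j)` of the cells: `a ∈ A` and `0 ≤ j ≤ F`. -/
def cellIndices {D : ℕ} (A : Finset (Pt D)) (F : ℕ) : Finset (Pt D × ℕ) :=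
  A ×ˢ Finset.range (F + 1)

/-! ### Sampling -/

/-- The draws that are made: `q` draws from each non-empty set `P p`, `p ∈ J`. -/
abbrev Draw {D : ℕ} (J : Finset (Pt D × ℕ)) (P : Pt D × ℕ → Finset (Pt D)) (q : ℕ) : Type :=
  ↥(J.filter fun p => (P p).Nonempty) × Fin q

/-- Outcomes of all the draws: a draw from `P p` yields a point of `P p`. -/
abbrev Sample {D : ℕ} (J : Finset (Pt D × ℕ)) (P : Pt D × ℕ → Finset (Pt D)) (q : ℕ) : Type :=
  ∀ d : Draw J P q, ↥(P d.1.1)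

/-- The law of the outcomes: all draws are independent, and each draw from `P p` is uniform. -/
def sampleLaw {D : ℕ} (J : Finset (Pt D × ℕ)) (P : Pt D × ℕ → Finset (Pt D)) (q : ℕ) :
    MeasureTheory.Measure (Sample J P q) :=
  MeasureTheory.Measure.pi fun _ => ProbabilityTheory.uniformOn Set.univ

/-- The set of all drawn points. -/
def sampledSet {D : ℕ} {J : Finset (Pt D × ℕ)} {P : Pt D × ℕ → Finset (Pt D)} {q : ℕ}
    (ω : Sample J P q) : Finset (Pt D) :=
  Finset.univ.image fun d => (ω d : Pt D)

/-- Each time a point is drawn from `P p`, its weight is increased by `|P p| / q`. -/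
def sampledWeight {D : ℕ} {J : Finset (Pt D × ℕ)} {P : Pt D × ℕ → Finset (Pt D)} {q : ℕ}
    (ω : Sample J P q) (x : Pt D) : ℝ :=
  ∑ d, if (ω d : Pt D) = x then ((P d.1.1).card : ℝ) / q else 0

/-! ### The variant with integer weights

From each cell `C p` a remainder of `|C p| mod q` points is set aside, and these points are kept
with weight `1`; the `q` draws are made from the other points `P p`, whose number is a
multiple of `q`. -/

/-- Each `P p` is obtained from `C p` by setting aside `|C p| mod q` points. -/
def IsDivisiblePart {D : ℕ} (J : Finset (Pt D × ℕ)) (C P : Pt D × ℕ → Finset (Pt D)) (q : ℕ) :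
    Prop :=
  ∀ p ∈ J, P p ⊆ C p ∧ (C p \ P p).card = (C p).card % q

/-- All the points that are set aside. -/
def remainder {D : ℕ} (J : Finset (Pt D × ℕ)) (C P : Pt D × ℕ → Finset (Pt D)) :
    Finset (Pt D) :=
  J.biUnion fun p => C p \ P p

/-- The drawn points together with the points set aside. -/
def integerSet {D : ℕ} {J : Finset (Pt D × ℕ)} (C : Pt D × ℕ → Finset (Pt D))
    {P : Pt D × ℕ → Finset (Pt D)} {q : ℕ} (ω : Sample J P q) : Finset (Pt D) :=
  sampledSet ω ∪ remainder J C P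

/-- Each time a point is drawn from `P p`, its weight is increased by the integer `|P p| / q`;
points set aside have weight `1`. -/
def integerWeight {D : ℕ} {J : Finset (Pt D × ℕ)} (C : Pt D × ℕ → Finset (Pt D))
    {P : Pt D × ℕ → Finset (Pt D)} {q : ℕ} (ω : Sample J P q) (x : Pt D) : ℕ :=
  (∑ d, if (ω d : Pt D) = x then (P d.1.1).card / q else 0) +
    if x ∈ remainder J C P then 1 else 0

end FuzzyKMeans

end

/-! Both costs of `M` are sums of a function of the single point `x`: the squared distance to `M`,
or the optimal fuzzy cost of `x`, which lies between `0` and that squared distance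
(`pointCost_le_infDist_sq`). On a cell these values lie in an interval `[0, B]` with `B` the
`cellBound`, so by Hoeffding's inequality the sampled estimate for a cell is off by at most `l *
|cell| * B`, except with probability `2 exp(-2 q l²)`.

The rings make this error affordable. Within a ring the distance to the centre `a` varies by a
factor of at most 2, or is at most `R`, so `B` is at most a constant times the sum of the squared
distance from any point of the cell to `M`, that from the point to `A`, and `R²`. Summation over all
cells and the bicriteria property give `∑ |cell| * B ≤ 34 α km(X,1,M)`
(`sum_card_mul_cellBound_le`). With `l = ε / (34 α K^(m-1))` the error is at most `ε / K^(m-1) *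
km(X,1,M)`. This is the `K`-means claim, and also the fuzzy claim, because `km ≤ K^(m-1) φ` by the
power mean inequality (`kmeansCost_le_fuzzyCost`).

A union bound over at most `γ^K` sets `M`, two costs and at most `2βKF` cells is what `q` is made
for (`failure_probability_le`). Points set aside in the integer variant contribute exactly, so only
the draws err and the same estimate applies. -/

noncomputable section

namespace FuzzyKMeans

/-! ### Pointwise form of the cost functions -/

variable {D : ℕ}

/-- Membership vectors of a single point, extended to the whole space. -/
def memberships (M : Finset (Pt D)) : Set (Pt D → ℝ) :=
  Set.pi Set.univ (fun _ => Set.Icc (0 : ℝ) 1) ∩ {s | ∑ μ ∈ M, s μ = 1}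

/-- Coordinates outside `M` do not affect the cost, but confining them to `[0,1]` as well makes the
product compact by Tychonoff. -/
theorem isCompact_memberships (M : Finset (Pt D)) : IsCompact (memberships M) := by
  refine (isCompact_univ_pi fun _ => isCompact_Icc).inter_right ?_
  exact isClosed_eq (by fun_prop) continuous_const

theorem single_mem_memberships {M : Finset (Pt D)} {ν : Pt D} (hν : ν ∈ M) :
    (fun μ => if μ = ν then (1 : ℝ) else 0) ∈ memberships M := by
  refine ⟨fun μ _ => ?_, ?_⟩
  · dsimp only
    split_ifs <;> simp
  · simp [hν]

/-- The fuzzy cost of a single point with given memberships. -/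
def pointCostWith (m : ℝ) (M : Finset (Pt D)) (x : Pt D) (s : Pt D → ℝ) : ℝ :=
  ∑ μ ∈ M, s μ ^ m * ‖x - μ‖ ^ 2

theorem exists_optimal_membership {m : ℝ} (hm : 1 < m) {M : Finset (Pt D)} (hM : M.Nonempty)
    (x : Pt D) :
    ∃ s ∈ memberships M, ∀ t ∈ memberships M, pointCostWith m M x s ≤ pointCostWith m M x t := by
  obtain ⟨ν, hν⟩ := hM
  have hc : Continuous (pointCostWith m M x) := by
    unfold pointCostWith
    refine continuous_finsetSum _ fun μ _ => ?_
    exact ((continuous_apply μ).rpow_const fun _ => Or.inr (by linarith)).mul continuous_const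
  obtain ⟨s, hs, hmin⟩ := (isCompact_memberships M).exists_isMinOn
    ⟨_, single_mem_memberships hν⟩ hc.continuousOn
  exact ⟨s, hs, fun t ht => hmin ht⟩

/-- The fuzzy cost of a single point with optimal memberships. -/
def pointCost (m : ℝ) (M : Finset (Pt D)) (x : Pt D) : ℝ :=
  sInf (pointCostWith m M x '' memberships M)

theorem pointCost_spec {m : ℝ} (hm : 1 < m) {M : Finset (Pt D)} (hM : M.Nonempty) (x : Pt D) :
    ∃ s ∈ memberships M, pointCostWith m M x s = pointCost m M x ∧
      ∀ t ∈ memberships M, pointCost m M x ≤ pointCostWith m M x t := by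
  obtain ⟨s, hs, hmin⟩ := exists_optimal_membership hm hM x
  have h : IsLeast (pointCostWith m M x '' memberships M) (pointCostWith m M x s) :=
    ⟨⟨s, hs, rfl⟩, by rintro _ ⟨t, ht, rfl⟩; exact hmin t ht⟩
  have he : pointCost m M x = pointCostWith m M x s := h.csInf_eq
  exact ⟨s, hs, he.symm, fun t ht => he ▸ hmin t ht⟩

/-- The constraints on `r` do not link different points, so the minimisation decouples. -/
theorem fuzzyCost_eq_sum {m : ℝ} (hm : 1 < m) {M : Finset (Pt D)} (hM : M.Nonempty)
    (X : Finset (Pt D)) (w : Pt D → ℝ) (hw : ∀ x, 0 ≤ w x) :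
    fuzzyCost m X w M = ∑ x ∈ X, w x * pointCost m M x := by
  choose s hs hse hsl using fun x : Pt D => pointCost_spec hm hM x
  refine IsLeast.csInf_eq ⟨⟨s, fun x _ => ⟨fun μ _ => (hs x).1 μ trivial, (hs x).2⟩, ?_⟩, ?_⟩
  · exact Finset.sum_congr rfl fun x _ => by rw [← hse x]; rfl
  · rintro _ ⟨r, hr, rfl⟩
    refine Finset.sum_le_sum fun x hx => mul_le_mul_of_nonneg_left ?_ (hw x)
    -- `r x` is arbitrary off `M`; truncation restores the bounds there without changing the cost.
    have hmem : (fun μ => if μ ∈ M then r x μ else 0) ∈ memberships M := by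
      refine ⟨fun μ _ => ?_, ?_⟩
      · dsimp only
        split_ifs with h
        · exact (hr x hx).1 μ h
        · simp
      · rw [← (hr x hx).2]
        exact Finset.sum_congr rfl fun μ hμ => by simp [hμ]
    refine (hsl x _ hmem).trans_eq (Finset.sum_congr rfl fun μ hμ => by simp [hμ])

theorem infDist_le_norm_sub {M : Finset (Pt D)} {μ : Pt D} (hμ : μ ∈ M) (x : Pt D) :
    Metric.infDist x (M : Set (Pt D)) ≤ ‖x - μ‖ := by
  rw [← dist_eq_norm]
  exact Metric.infDist_le_dist_of_mem (by exact_mod_cast hμ)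

theorem exists_infDist_eq_norm_sub {M : Finset (Pt D)} (hM : M.Nonempty) (x : Pt D) :
    ∃ μ ∈ M, Metric.infDist x (M : Set (Pt D)) = ‖x - μ‖ := by
  obtain ⟨μ, hμ, h⟩ := M.finite_toSet.isCompact.exists_infDist_eq_dist (by exact_mod_cast hM) x
  exact ⟨μ, by exact_mod_cast hμ, by rw [h, dist_eq_norm]⟩

theorem pointCost_nonneg {m : ℝ} (hm : 1 < m) {M : Finset (Pt D)} (hM : M.Nonempty) (x : Pt D) :
    0 ≤ pointCost m M x := by
  obtain ⟨s, hs, h, -⟩ := pointCost_spec hm hM x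
  rw [← h]
  exact Finset.sum_nonneg fun μ _ =>
    mul_nonneg (Real.rpow_nonneg (hs.1 μ trivial).1 _) (sq_nonneg _)

theorem pointCost_le_infDist_sq {m : ℝ} (hm : 1 < m) {M : Finset (Pt D)} (hM : M.Nonempty)
    (x : Pt D) : pointCost m M x ≤ Metric.infDist x (M : Set (Pt D)) ^ 2 := by
  obtain ⟨ν, hν, h⟩ := exists_infDist_eq_norm_sub hM x
  obtain ⟨-, -, -, hl⟩ := pointCost_spec hm hM x
  refine (hl _ (single_mem_memberships hν)).trans_eq ?_
  rw [h, pointCostWith, Finset.sum_eq_single_of_mem ν hν]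
  · simp
  · intro μ _ hne
    simp [hne, Real.zero_rpow (by linarith : m ≠ 0)]

/-- The power mean inequality gives `1 = (∑ s)^m ≤ |M|^(m-1) ∑ s^m`, and no mean is closer than the
nearest one. -/
theorem infDist_sq_le_pointCost {m : ℝ} (hm : 1 < m) {M : Finset (Pt D)} (hM : M.Nonempty)
    (x : Pt D) : Metric.infDist x (M : Set (Pt D)) ^ 2 ≤ (M.card : ℝ) ^ (m - 1) * pointCost m M x := by
  obtain ⟨s, hs, h, -⟩ := pointCost_spec hm hM x
  have h1 := Real.rpow_sum_le_const_mul_sum_rpow_of_nonneg M hm.le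
    (f := s) fun μ _ => (hs.1 μ trivial).1
  rw [show ∑ μ ∈ M, s μ = 1 from hs.2, Real.one_rpow] at h1
  rw [← h]
  set d := Metric.infDist x (M : Set (Pt D)) ^ 2 with hd
  have h2 : (∑ μ ∈ M, s μ ^ m) * d ≤ pointCostWith m M x s := by
    rw [Finset.sum_mul]
    refine Finset.sum_le_sum fun μ hμ => mul_le_mul_of_nonneg_left ?_
      (Real.rpow_nonneg (hs.1 μ trivial).1 _)
    exact pow_le_pow_left₀ Metric.infDist_nonneg (infDist_le_norm_sub hμ x) 2
  calc d ≤ ((M.card : ℝ) ^ (m - 1) * ∑ μ ∈ M, s μ ^ m) * d :=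
        le_mul_of_one_le_left (sq_nonneg _) h1
    _ = (M.card : ℝ) ^ (m - 1) * ((∑ μ ∈ M, s μ ^ m) * d) := by ring
    _ ≤ _ := mul_le_mul_of_nonneg_left h2 (Real.rpow_nonneg (Nat.cast_nonneg _) _)

theorem kmeansCost_le_fuzzyCost {m : ℝ} (hm : 1 < m) {M : Finset (Pt D)} (hM : M.Nonempty) {K : ℕ}
    (hK : M.card ≤ K) (X : Finset (Pt D)) :
    kmeansCost X 1 M ≤ (K : ℝ) ^ (m - 1) * fuzzyCost m X 1 M := by
  rw [fuzzyCost_eq_sum hm hM X 1 fun _ => zero_le_one, Finset.mul_sum]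
  refine Finset.sum_le_sum fun x _ => ?_
  simp only [Pi.one_apply, one_mul]
  refine (infDist_sq_le_pointCost hm hM x).trans
    (mul_le_mul_of_nonneg_right ?_ (pointCost_nonneg hm hM x))
  exact Real.rpow_le_rpow (Nat.cast_nonneg _) (by exact_mod_cast hK) (by linarith)

theorem kmeansCost_one_nonneg (X M : Finset (Pt D)) : 0 ≤ kmeansCost X 1 M :=
  Finset.sum_nonneg fun _ _ => mul_nonneg zero_le_one (sq_nonneg _)

theorem IsBicriteria.kmeansCost_le {α β : ℝ} (hα : 1 ≤ α) {K : ℕ} {X A M : Finset (Pt D)}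
    (h : IsBicriteria α β K X A) (hM : M.Nonempty) (hK : M.card ≤ K) :
    kmeansCost X 1 A ≤ α * kmeansCost X 1 M := by
  refine h.2.2.trans (mul_le_mul_of_nonneg_left (csInf_le ⟨0, ?_⟩ ⟨M, hM, hK, rfl⟩) (by linarith))
  rintro _ ⟨M', -, -, rfl⟩
  exact kmeansCost_one_nonneg X M'

end FuzzyKMeans
end
noncomputable section

namespace FuzzyKMeans

/-! ### Concentration -/

open MeasureTheory ProbabilityTheory

theorem integral_uniformOn_univ {Ω : Type*} [Fintype Ω] [MeasurableSpace Ω]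
    [MeasurableSingletonClass Ω] (f : Ω → ℝ) :
    ∫ x, f x ∂(uniformOn (Set.univ : Set Ω)) = (∑ x, f x) / Fintype.card Ω := by
  rw [uniformOn, ProbabilityTheory.cond, Measure.restrict_univ, integral_smul_measure,
    integral_count, Measure.count_univ]
  simp [div_eq_inv_mul]

variable {D : ℕ} {J : Finset (Pt D × ℕ)} {P : Pt D × ℕ → Finset (Pt D)} {q : ℕ}

instance (d : Draw J P q) : Nonempty ↥(P d.1.1) :=
  (Finset.mem_filter.1 d.1.2).2.to_subtype

instance : IsProbabilityMeasure (sampleLaw J P q) := by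
  unfold sampleLaw
  infer_instance

theorem integral_sampleLaw_eval (d : Draw J P q) (f : Pt D → ℝ) :
    ∫ ω, f (ω d) ∂(sampleLaw J P q) = (∑ x ∈ P d.1.1, f x) / (P d.1.1).card := by
  have h := integral_comp_eval (μ := fun d : Draw J P q =>
    (uniformOn Set.univ : Measure ↥(P d.1.1))) (i := d) (f := fun x => f x)
    (measurable_of_finite _).aestronglyMeasurable
  refine h.trans ?_
  rw [integral_uniformOn_univ, Fintype.card_coe, Finset.sum_coe_sort (P d.1.1) f]

theorem iIndepFun_sampleLaw (f : Draw J P q → Pt D → ℝ) :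
    iIndepFun (fun d (ω : Sample J P q) => f d (ω d)) (sampleLaw J P q) :=
  iIndepFun_pi (X := fun d (x : ↥(P d.1.1)) => f d x)
    fun _ => (measurable_of_finite _).aemeasurable

/-- One-sided Hoeffding: each centred draw is sub-Gaussian with variance proxy `(b - a)² / 4`. -/
theorem sampleLaw_real_upper_le (p : ↥(J.filter fun p => (P p).Nonempty)) (f : Pt D → ℝ)
    {a b l : ℝ} (hl : 0 ≤ l) (hab : a < b) (hf : ∀ x ∈ P p.1, f x ∈ Set.Icc a b) :
    (sampleLaw J P q).real {ω | q * l * (b - a) ≤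
      ∑ i : Fin q, (f (ω (p, i)) - (∑ x ∈ P p.1, f x) / (P p.1).card)} ≤
      Real.exp (-(2 * q * l ^ 2)) := by
  rcases Nat.eq_zero_or_pos q with rfl | hq
  · simp
  have hq' : (0 : ℝ) < q := by exact_mod_cast hq
  let Y : Fin q → Sample J P q → ℝ := fun i ω =>
    f (ω (p, i)) - (∑ x ∈ P p.1, f x) / (P p.1).card
  have hind : iIndepFun Y (sampleLaw J P q) :=
    (iIndepFun_sampleLaw fun d x => f x - (∑ x ∈ P d.1.1, f x) / (P d.1.1).card).precomp
      (g := fun i : Fin q => ((p, i) : Draw J P q)) (Prod.mk_right_injective p)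
  have hsub : ∀ i ∈ (Finset.univ : Finset (Fin q)),
      HasSubgaussianMGF (Y i) ((‖b - a‖₊ / 2) ^ 2) (sampleLaw J P q) := by
    intro i _
    have h := hasSubgaussianMGF_of_mem_Icc (μ := sampleLaw J P q)
      (X := fun ω => f (ω ((p, i) : Draw J P q))) (a := a) (b := b)
      (measurable_of_finite _).aemeasurable
      (Filter.Eventually.of_forall fun ω => hf _ (ω (p, i)).2)
    rwa [integral_sampleLaw_eval] at h
  have h := HasSubgaussianMGF.measure_sum_ge_le_of_iIndepFun hind hsub
    (ε := q * l * (b - a)) (by have := sub_pos.2 hab; positivity)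
  refine h.trans_eq ?_
  have hba : 0 < b - a := sub_pos.2 hab
  congr 1
  simp only [Finset.sum_const, Finset.card_univ, Fintype.card_fin, nsmul_eq_mul]
  push_cast
  rw [Real.norm_of_nonneg hba.le]
  field_simp

theorem sampleLaw_real_deviation_le (p : ↥(J.filter fun p => (P p).Nonempty)) (f : Pt D → ℝ)
    {B l : ℝ} (hl : 0 ≤ l) (hf : ∀ x ∈ P p.1, f x ∈ Set.Icc 0 B) :
    (sampleLaw J P q).real {ω | q * l * B <
      |∑ i : Fin q, (f (ω (p, i)) - (∑ x ∈ P p.1, f x) / (P p.1).card)|} ≤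
      2 * Real.exp (-(2 * q * l ^ 2)) := by
  obtain ⟨y, hy⟩ := (Finset.mem_filter.1 p.2).2
  -- For `B = 0` the Hoeffding interval degenerates, but then `f` vanishes on the part and the
  -- strict inequality never holds.
  rcases ((hf y hy).1.trans (hf y hy).2).eq_or_lt with hB | hB
  · have h0 : ∀ x ∈ P p.1, f x = 0 := fun x hx =>
      le_antisymm ((hf x hx).2.trans_eq hB.symm) (hf x hx).1
    have : {ω : Sample J P q | q * l * B <
        |∑ i : Fin q, (f (ω (p, i)) - (∑ x ∈ P p.1, f x) / (P p.1).card)|} = ∅ := by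
      ext ω
      simp [← hB, Finset.sum_eq_zero h0, h0 _ (ω (p, _)).2]
    rw [this]
    simp
    positivity
  · have h1 := sampleLaw_real_upper_le (q := q) p f hl hB hf
    have h2 := sampleLaw_real_upper_le (q := q) p (fun x => -f x) (a := -B) (b := 0) hl
      (by linarith) fun x hx => ⟨by linarith [(hf x hx).2], by linarith [(hf x hx).1]⟩
    rw [two_mul]
    refine (measureReal_mono ?_).trans ((measureReal_union_le _ _).trans (add_le_add h1 h2))
    intro ω hω
    rw [Set.mem_ofPred_eq] at hω
    rcases lt_abs.1 hω with h | h
    · left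
      simpa using h.le
    · right
      rw [← Finset.sum_neg_distrib] at h
      rw [Set.mem_ofPred_eq, zero_sub, neg_neg]
      refine h.le.trans_eq (Finset.sum_congr rfl fun i _ => ?_)
      rw [Finset.sum_neg_distrib]
      ring

/-- The weighted sum of the values of `f` over all the draws. -/
def drawSum (ω : Sample J P q) (f : Pt D → ℝ) : ℝ :=
  ∑ d : Draw J P q, ((P d.1.1).card : ℝ) / q * f (ω d)

theorem sum_nonempty_parts (J : Finset (Pt D × ℕ)) (P : Pt D × ℕ → Finset (Pt D))
    (h : Pt D × ℕ → ℝ) (h0 : ∀ p, P p = ∅ → h p = 0) :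
    ∑ p : ↥(J.filter fun p => (P p).Nonempty), h p.1 = ∑ p ∈ J, h p := by
  rw [Finset.sum_coe_sort (J.filter fun p => (P p).Nonempty) h, Finset.sum_filter]
  refine Finset.sum_congr rfl fun p _ => ?_
  split_ifs with hp
  · rfl
  · exact (h0 p (Finset.not_nonempty_iff_eq_empty.1 hp)).symm

theorem abs_drawSum_sub_le (hq : 0 < q) (ω : Sample J P q) (f : Pt D → ℝ) {l : ℝ}
    (B : Pt D × ℕ → ℝ)
    (h : ∀ p : ↥(J.filter fun p => (P p).Nonempty),
      |∑ i : Fin q, (f (ω (p, i)) - (∑ x ∈ P p.1, f x) / (P p.1).card)| ≤ q * l * B p.1) :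
    |drawSum ω f - ∑ p ∈ J, ∑ x ∈ P p, f x| ≤ l * ∑ p ∈ J, (P p).card * B p := by
  have hq' : (0 : ℝ) < q := by exact_mod_cast hq
  rw [← sum_nonempty_parts J P (fun p => ∑ x ∈ P p, f x) (by intro p hp; simp [hp]),
    ← sum_nonempty_parts J P (fun p => (P p).card * B p) (by intro p hp; simp [hp]),
    -- It remains to compare part by part: the error on `P p` is `|P p| / q` times the deviation
    -- bounded in `h`.
    drawSum, Fintype.sum_prod_type, ← Finset.sum_sub_distrib, Finset.mul_sum]
  refine (Finset.abs_sum_le_sum_abs _ _).trans (Finset.sum_le_sum fun p _ => ?_)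
  have hp : (0 : ℝ) < (P p.1).card := by
    exact_mod_cast Finset.card_pos.2 (Finset.mem_filter.1 p.2).2
  have e : ∑ i : Fin q, ((P p.1).card : ℝ) / q * f (ω (p, i)) - ∑ x ∈ P p.1, f x =
      (P p.1).card / q * ∑ i : Fin q, (f (ω (p, i)) - (∑ x ∈ P p.1, f x) / (P p.1).card) := by
    rw [Finset.sum_sub_distrib, ← Finset.mul_sum, Finset.sum_const, Finset.card_univ,
      Fintype.card_fin, nsmul_eq_mul]
    field_simp
  rw [e, abs_mul, abs_of_pos (by positivity)]
  refine (mul_le_mul_of_nonneg_left (h p) (by positivity)).trans_eq ?_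
  field_simp

/-- Simultaneous concentration of the weighted sums of finitely many functions. -/
theorem one_sub_le_sampleLaw_real (hq : 0 < q) {ι : Type*} (T : Finset ι) (f : ι → Pt D → ℝ)
    (B : ι → Pt D × ℕ → ℝ) {l η : ℝ} (hl : 0 ≤ l)
    (hf : ∀ t ∈ T, ∀ p ∈ J, ∀ x ∈ P p, f t x ∈ Set.Icc 0 (B t p))
    (hη : T.card * J.card * (2 * Real.exp (-(2 * q * l ^ 2))) ≤ η) :
    1 - η ≤ (sampleLaw J P q).real {ω | ∀ t ∈ T,
      |drawSum ω (f t) - ∑ p ∈ J, ∑ x ∈ P p, f t x| ≤ l * ∑ p ∈ J, (P p).card * B t p} := by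
  set G := {ω : Sample J P q | ∀ t ∈ T,
      |drawSum ω (f t) - ∑ p ∈ J, ∑ x ∈ P p, f t x| ≤ l * ∑ p ∈ J, (P p).card * B t p} with hG
  let E : ι × ↥(J.filter fun p => (P p).Nonempty) → Set (Sample J P q) := fun z =>
    {ω | q * l * B z.1 z.2.1 <
      |∑ i : Fin q, (f z.1 (ω (z.2, i)) - (∑ x ∈ P z.2.1, f z.1 x) / (P z.2.1).card)|}
  have hsub : Gᶜ ⊆ ⋃ z ∈ T ×ˢ Finset.univ, E z := by
    intro ω hω
    by_contra hcon
    refine hω fun t ht => abs_drawSum_sub_le hq ω (f t) (B t) fun p => ?_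
    by_contra hlt
    exact hcon (Set.mem_biUnion (x := (t, p)) (by simp [ht]) (not_le.1 hlt))
  have hbad : (sampleLaw J P q).real Gᶜ ≤ η := by
    refine (measureReal_mono hsub (measure_ne_top _ _)).trans
      ((measureReal_biUnion_finset_le _ _).trans ?_)
    have hle : ∀ z ∈ T ×ˢ (Finset.univ : Finset ↥(J.filter fun p => (P p).Nonempty)),
        (sampleLaw J P q).real (E z) ≤ 2 * Real.exp (-(2 * q * l ^ 2)) := fun z hz =>
      sampleLaw_real_deviation_le z.2 (f z.1) hl
        (hf z.1 (Finset.mem_product.1 hz).1 z.2.1 (Finset.mem_filter.1 z.2.2).1)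
    refine (Finset.sum_le_card_nsmul _ _ _ hle).trans (le_trans ?_ hη)
    rw [nsmul_eq_mul, Finset.card_product, Finset.card_univ, Fintype.card_coe]
    push_cast
    refine mul_le_mul_of_nonneg_right ?_ (by positivity)
    exact mul_le_mul_of_nonneg_left (by exact_mod_cast Finset.card_filter_le _ _) (by positivity)
  -- Subadditivity suffices here, so no measurability of `G` is needed.
  have h1 : (1 : ℝ) ≤ (sampleLaw J P q).real G + (sampleLaw J P q).real Gᶜ := by
    rw [← probReal_univ (μ := sampleLaw J P q), ← Set.union_compl_self G]
    exact measureReal_union_le _ _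
  linarith

end FuzzyKMeans
end
noncomputable section

namespace FuzzyKMeans

/-! ### Geometry of the cells -/

variable {D : ℕ} {X A : Finset (Pt D)} {c : Pt D → Pt D} {R : ℝ}

theorem norm_sub_le_of_mem_ring {a x : Pt D} {j : ℕ} (h : x ∈ ring R a j) :
    ‖x - a‖ ≤ 2 ^ j * R := by
  unfold ring at h
  split_ifs at h with hj
  · subst hj
    simpa [dist_eq_norm] using h
  · simpa [dist_eq_norm] using h.1

theorem lt_norm_sub_of_mem_ring {a x : Pt D} {j : ℕ} (hj : j ≠ 0) (h : x ∈ ring R a j) :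
    2 ^ (j - 1) * R < ‖x - a‖ := by
  rw [ring, if_neg hj] at h
  simpa [dist_eq_norm] using h.2

theorem mem_ring_of_norm {a x : Pt D} {j : ℕ} (h : ‖x - a‖ ≤ 2 ^ j * R)
    (h' : j ≠ 0 → 2 ^ (j - 1) * R < ‖x - a‖) : x ∈ ring R a j := by
  unfold ring
  split_ifs with hj
  · subst hj
    simpa [dist_eq_norm] using h
  · simpa [dist_eq_norm] using ⟨h, h' hj⟩

theorem ring_index_le (hR : 0 ≤ R) {a x : Pt D} {i j : ℕ} (hi : x ∈ ring R a i)
    (hj : x ∈ ring R a j) : i ≤ j := by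
  by_contra! hlt
  have h1 := lt_norm_sub_of_mem_ring (by omega) hi
  have h2 := norm_sub_le_of_mem_ring hj
  have h3 : (2 : ℝ) ^ j * R ≤ 2 ^ (i - 1) * R :=
    mul_le_mul_of_nonneg_right (pow_le_pow_right₀ one_le_two (by omega)) hR
  linarith

theorem disjoint_cell (hR : 0 ≤ R) {p p' : Pt D × ℕ} (h : p ≠ p') :
    Disjoint (cell X c R p) (cell X c R p') := by
  rw [Finset.disjoint_left]
  intro x hx hx'
  obtain ⟨-, h1, h2⟩ := Finset.mem_filter.1 hx
  obtain ⟨-, h1', h2'⟩ := Finset.mem_filter.1 hx'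
  have e : p.1 = p'.1 := h1.symm.trans h1'
  rw [← e] at h2'
  exact h (Prod.ext e (le_antisymm (ring_index_le hR h2 h2') (ring_index_le hR h2' h2)))

theorem IsClosestAssignment.infDist_eq (hc : IsClosestAssignment X A c) {x : Pt D} (hx : x ∈ X) :
    Metric.infDist x (A : Set (Pt D)) = ‖x - c x‖ := by
  obtain ⟨h1, h2⟩ := hc x hx
  refine le_antisymm (infDist_le_norm_sub h1 x) ?_
  obtain ⟨a, ha, e⟩ := exists_infDist_eq_norm_sub ⟨_, h1⟩ x
  exact e ▸ h2 a ha

theorem IsClosestAssignment.kmeansCost_eq (hc : IsClosestAssignment X A c) :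
    kmeansCost X 1 A = ∑ x ∈ X, ‖x - c x‖ ^ 2 :=
  Finset.sum_congr rfl fun x hx => by rw [hc.infDist_eq hx, Pi.one_apply, one_mul]

theorem baseRadius_nonneg (α : ℝ) (X A : Finset (Pt D)) : 0 ≤ baseRadius α X A :=
  Real.sqrt_nonneg _

theorem card_mul_baseRadius_sq {α : ℝ} (hαN : 1 < α * (X.card : ℝ)) :
    α * X.card * baseRadius α X A ^ 2 = kmeansCost X 1 A := by
  rw [baseRadius, Real.sq_sqrt (div_nonneg (kmeansCost_one_nonneg X A) (by linarith)),
    mul_div_assoc', mul_div_cancel_left₀ _ (zero_lt_one.trans hαN).ne']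

theorem alpha_mul_card_le {α : ℝ} {N : ℕ} (hαN : 1 < α * (N : ℝ)) :
    α * N ≤ (2 ^ ringCount α N) ^ 2 := by
  have h : (1 / 2) * Real.logb 2 (α * N) ≤ ringCount α N := Nat.le_ceil _
  have h2 : Real.logb 2 (α * N) ≤ ((ringCount α N * 2 : ℕ) : ℝ) := by
    push_cast
    linarith
  rw [Real.logb_le_iff_le_rpow one_lt_two (by linarith), Real.rpow_natCast, pow_mul] at h2
  exact h2

theorem one_le_ringCount {α : ℝ} {N : ℕ} (hαN : 1 < α * (N : ℝ)) : 1 ≤ ringCount α N :=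
  Nat.one_le_ceil_iff.2 (mul_pos (by norm_num) (Real.logb_pos one_lt_two hαN))

theorem biUnion_cell {α : ℝ} (hαN : 1 < α * (X.card : ℝ)) (hc : IsClosestAssignment X A c) :
    (cellIndices A (ringCount α X.card)).biUnion (cell X c (baseRadius α X A)) = X := by
  set R := baseRadius α X A with hR
  set F := ringCount α X.card with hF
  have hR0 : 0 ≤ R := baseRadius_nonneg α X A
  refine Finset.Subset.antisymm
    (Finset.biUnion_subset.2 fun p _ => Finset.filter_subset _ _) fun x hx => ?_
  -- One point costs at most the total `α N R²`, and `F` is chosen so that `α N ≤ 4^F`: the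
  -- outermost ball misses no point.
  have hle : ‖x - c x‖ ≤ 2 ^ F * R := by
    refine abs_le_of_sq_le_sq' ?_ (by positivity) |>.2
    calc ‖x - c x‖ ^ 2 ≤ kmeansCost X 1 A := by
          rw [hc.kmeansCost_eq]
          exact Finset.single_le_sum (f := fun x => ‖x - c x‖ ^ 2) (fun _ _ => sq_nonneg _) hx
      _ = α * X.card * R ^ 2 := (card_mul_baseRadius_sq hαN).symm
      _ ≤ (2 ^ F) ^ 2 * R ^ 2 :=
          mul_le_mul_of_nonneg_right (alpha_mul_card_le hαN) (sq_nonneg _)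
      _ = (2 ^ F * R) ^ 2 := by ring
  have hex : ∃ j, ‖x - c x‖ ≤ 2 ^ j * R := ⟨F, hle⟩
  -- The least admissible radius: its minimality puts `x` outside the next smaller ball.
  refine Finset.mem_biUnion.2 ⟨(c x, Nat.find hex), ?_, ?_⟩
  · refine Finset.mem_product.2 ⟨(hc x hx).1, Finset.mem_range.2 ?_⟩
    exact Nat.lt_succ_of_le (Nat.find_min' hex hle)
  · refine Finset.mem_filter.2 ⟨hx, rfl, mem_ring_of_norm (Nat.find_spec hex) fun h0 => ?_⟩
    exact not_le.1 (Nat.find_min hex (Nat.sub_lt (Nat.pos_of_ne_zero h0) one_pos))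

theorem sum_cells {α : ℝ} (hαN : 1 < α * (X.card : ℝ)) (hc : IsClosestAssignment X A c)
    (f : Pt D → ℝ) :
    ∑ p ∈ cellIndices A (ringCount α X.card), ∑ x ∈ cell X c (baseRadius α X A) p, f x =
      ∑ x ∈ X, f x := by
  rw [← Finset.sum_biUnion fun p _ p' _ h => disjoint_cell (baseRadius_nonneg α X A) h,
    biUnion_cell hαN hc]

/-- An upper bound of the cost of the points of the cell `p`. -/
def cellBound (R : ℝ) (M : Finset (Pt D)) (p : Pt D × ℕ) : ℝ :=
  2 * Metric.infDist p.1 (M : Set (Pt D)) ^ 2 + 2 * (2 ^ p.2 * R) ^ 2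

theorem cellBound_nonneg (R : ℝ) (M : Finset (Pt D)) (p : Pt D × ℕ) : 0 ≤ cellBound R M p := by
  unfold cellBound
  positivity

theorem infDist_sq_le_cellBound {p : Pt D × ℕ} {x : Pt D} (hx : x ∈ cell X c R p)
    (M : Finset (Pt D)) : Metric.infDist x (M : Set (Pt D)) ^ 2 ≤ cellBound R M p := by
  have h1 := norm_sub_le_of_mem_ring (Finset.mem_filter.1 hx).2.2
  have h2 : Metric.infDist x (M : Set (Pt D)) ≤ Metric.infDist p.1 (M : Set (Pt D)) + ‖x - p.1‖ := by
    rw [← dist_eq_norm]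
    exact Metric.infDist_le_infDist_add_dist
  have h3 := pow_le_pow_left₀ Metric.infDist_nonneg (h2.trans (add_le_add_right h1 _)) 2
  unfold cellBound
  nlinarith [sq_nonneg (Metric.infDist p.1 (M : Set (Pt D)) - 2 ^ p.2 * R)]

/-- With `ρ = 2^j R`, the triangle inequality bounds `cellBound` by `4 d(x,M)² + 6ρ²`; then `ρ² ≤
4‖x - c x‖² + R²` yields the constants 24 and 6. -/
theorem cellBound_le (hR : 0 ≤ R) {p : Pt D × ℕ} {x : Pt D} (hx : x ∈ cell X c R p)
    (M : Finset (Pt D)) : cellBound R M p ≤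
      4 * Metric.infDist x (M : Set (Pt D)) ^ 2 + 24 * ‖x - c x‖ ^ 2 + 6 * R ^ 2 := by
  obtain ⟨-, hcx, hr⟩ := Finset.mem_filter.1 hx
  have h1 := norm_sub_le_of_mem_ring hr
  have h2 : Metric.infDist p.1 (M : Set (Pt D)) ≤ Metric.infDist x (M : Set (Pt D)) + ‖x - p.1‖ := by
    rw [← dist_eq_norm, dist_comm]
    exact Metric.infDist_le_infDist_add_dist
  have h3 := pow_le_pow_left₀ Metric.infDist_nonneg (h2.trans (add_le_add_right h1 _)) 2
  have h4 : (2 ^ p.2 * R) ^ 2 ≤ 4 * ‖x - c x‖ ^ 2 + R ^ 2 := by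
    rw [hcx]
    rcases Nat.eq_zero_or_pos p.2 with h0 | h0
    · rw [h0]
      nlinarith [sq_nonneg ‖x - p.1‖]
    · have h5 := lt_norm_sub_of_mem_ring h0.ne' hr
      have h6 : (2 : ℝ) ^ p.2 = 2 ^ (p.2 - 1) * 2 := by
        rw [← pow_succ, Nat.sub_add_cancel h0]
      have h7 := pow_le_pow_left₀ (by positivity) h5.le 2
      rw [h6]
      nlinarith [sq_nonneg R]
  unfold cellBound
  nlinarith [sq_nonneg (Metric.infDist x (M : Set (Pt D)) - 2 ^ p.2 * R)]

theorem sum_card_mul_cellBound_le {α β : ℝ} {K : ℕ} (hα : 1 ≤ α) (hαN : 1 < α * (X.card : ℝ))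
    (hA : IsBicriteria α β K X A) (hc : IsClosestAssignment X A c) {M : Finset (Pt D)}
    (hM : M.Nonempty) (hMK : M.card ≤ K) :
    ∑ p ∈ cellIndices A (ringCount α X.card), (cell X c (baseRadius α X A) p).card *
      cellBound (baseRadius α X A) M p ≤ 34 * α * kmeansCost X 1 M := by
  set R := baseRadius α X A with hR
  have hR0 : 0 ≤ R := baseRadius_nonneg α X A
  have hkA := hA.kmeansCost_le hα hM hMK
  have hkM := kmeansCost_one_nonneg X M
  have hN : (X.card : ℝ) * R ^ 2 ≤ kmeansCost X 1 A := by
    rw [← card_mul_baseRadius_sq (A := A) hαN, mul_assoc]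
    exact le_mul_of_one_le_left (by positivity) hα
  calc _ ≤ ∑ p ∈ cellIndices A (ringCount α X.card), ∑ x ∈ cell X c R p,
        (4 * Metric.infDist x (M : Set (Pt D)) ^ 2 + 24 * ‖x - c x‖ ^ 2 + 6 * R ^ 2) := by
        refine Finset.sum_le_sum fun p _ => ?_
        rw [← nsmul_eq_mul]
        exact Finset.card_nsmul_le_sum _ _ _ fun x hx => cellBound_le hR0 hx M
    _ = 4 * kmeansCost X 1 M + 24 * kmeansCost X 1 A + 6 * (X.card * R ^ 2) := by
        rw [sum_cells hαN hc, Finset.sum_add_distrib, Finset.sum_add_distrib, ← Finset.mul_sum,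
          ← Finset.mul_sum, hc.kmeansCost_eq, Finset.sum_const, nsmul_eq_mul]
        simp only [kmeansCost, Pi.one_apply, one_mul]
        ring
    -- `4 + 24α + 6α ≤ 34α`, since `α ≥ 1`.
    _ ≤ _ := by nlinarith

/-! ### Weights of the samples -/

variable {J : Finset (Pt D × ℕ)} {C P : Pt D × ℕ → Finset (Pt D)} {q : ℕ}

theorem sampledWeight_nonneg (ω : Sample J P q) (x : Pt D) : 0 ≤ sampledWeight ω x :=
  Finset.sum_nonneg fun d _ => by split_ifs <;> positivity

theorem sampledWeight_pos (hq : 0 < q) {ω : Sample J P q} {s : Pt D} (hs : s ∈ sampledSet ω) :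
    0 < sampledWeight ω s := by
  obtain ⟨d, -, rfl⟩ := Finset.mem_image.1 hs
  have hd : 0 < (P d.1.1).card := Finset.card_pos.2 (Finset.mem_filter.1 d.1.2).2
  refine Finset.sum_pos' (fun d _ => by split_ifs <;> positivity) ⟨d, Finset.mem_univ _, ?_⟩
  rw [if_pos rfl]
  positivity

theorem sum_sampledWeight_mul (ω : Sample J P q) {S : Finset (Pt D)} (hS : sampledSet ω ⊆ S)
    (f : Pt D → ℝ) : ∑ s ∈ S, sampledWeight ω s * f s = drawSum ω f := by
  simp only [sampledWeight, drawSum, Finset.sum_mul]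
  rw [Finset.sum_comm]
  refine Finset.sum_congr rfl fun d _ => ?_
  simp only [ite_mul, zero_mul]
  rw [Finset.sum_ite_eq, if_pos (hS (Finset.mem_image_of_mem _ (Finset.mem_univ d)))]

/-- A constant function never deviates from its mean, so the error estimate holds with bound zero
for every outcome. -/
theorem drawSum_one (hq : 0 < q) (ω : Sample J P q) :
    drawSum ω (fun _ => 1) = ∑ p ∈ J, ∑ _x ∈ P p, (1 : ℝ) := by
  have h := abs_drawSum_sub_le hq ω (fun _ => 1) (l := 0) 0 fun p => by
    have hp : ((P p.1).card : ℝ) ≠ 0 := by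
      exact_mod_cast (Finset.card_pos.2 (Finset.mem_filter.1 p.2).2).ne'
    simp [hp]
  rw [zero_mul] at h
  exact sub_eq_zero.1 (abs_nonpos_iff.1 h)

theorem sampledSet_subset {Y : Finset (Pt D)} (hP : ∀ p ∈ J, P p ⊆ Y) (ω : Sample J P q) :
    sampledSet ω ⊆ Y := by
  refine Finset.image_subset_iff.2 fun d _ => ?_
  exact hP _ (Finset.mem_filter.1 d.1.2).1 (ω d).2

theorem IsDivisiblePart.dvd_card (h : IsDivisiblePart J C P q) {p : Pt D × ℕ} (hp : p ∈ J) :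
    q ∣ (P p).card := by
  obtain ⟨h1, h2⟩ := h p hp
  have h3 := Finset.card_sdiff_add_card_eq_card h1
  have h4 := Nat.mod_add_div (C p).card q
  exact ⟨(C p).card / q, by omega⟩

theorem integerWeight_cast (hq : 0 < q) (h : IsDivisiblePart J C P q) (ω : Sample J P q)
    (x : Pt D) : (integerWeight C ω x : ℝ) =
      sampledWeight ω x + if x ∈ remainder J C P then 1 else 0 := by
  unfold integerWeight sampledWeight
  push_cast
  congr 1
  refine Finset.sum_congr rfl fun d _ => ?_
  split_ifs
  · exact Nat.cast_div (h.dvd_card (Finset.mem_filter.1 d.1.2).1) (by exact_mod_cast hq.ne')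
  · rfl

theorem sum_integerWeight_mul (hq : 0 < q) (h : IsDivisiblePart J C P q)
    (hC : ∀ p p', p ≠ p' → Disjoint (C p) (C p')) (ω : Sample J P q) (f : Pt D → ℝ) :
    ∑ s ∈ integerSet C ω, (integerWeight C ω s : ℝ) * f s =
      drawSum ω f + ∑ p ∈ J, ∑ x ∈ C p \ P p, f x := by
  simp only [integerWeight_cast hq h, add_mul, Finset.sum_add_distrib]
  rw [sum_sampledWeight_mul ω (S := integerSet C ω) Finset.subset_union_left]
  simp only [ite_mul, one_mul, zero_mul]
  rw [← Finset.sum_filter, Finset.filter_mem_eq_inter, integerSet,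
    Finset.inter_eq_right.2 Finset.subset_union_right, remainder, Finset.sum_biUnion]
  exact fun p _ p' _ hne => (hC p p' hne).mono Finset.sdiff_subset Finset.sdiff_subset

theorem integerWeight_pos (hq : 0 < q) (h : IsDivisiblePart J C P q) {ω : Sample J P q}
    {s : Pt D} (hs : s ∈ integerSet C ω) : 0 < integerWeight C ω s := by
  rw [← Nat.cast_pos (α := ℝ), integerWeight_cast hq h]
  rcases Finset.mem_union.1 hs with hs | hs
  · exact add_pos_of_pos_of_nonneg (sampledWeight_pos hq hs) (by split_ifs <;> simp)
  · rw [if_pos hs]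
    exact add_pos_of_nonneg_of_pos (sampledWeight_nonneg ω s) one_pos

theorem sum_parts_add_sum_sdiff (hP : ∀ p ∈ J, P p ⊆ C p) (f : Pt D → ℝ) :
    ∑ p ∈ J, ∑ x ∈ P p, f x + ∑ p ∈ J, ∑ x ∈ C p \ P p, f x = ∑ p ∈ J, ∑ x ∈ C p, f x := by
  rw [← Finset.sum_add_distrib]
  refine Finset.sum_congr rfl fun p hp => ?_
  rw [add_comm, Finset.sum_sdiff (hP p hp)]

end FuzzyKMeans
end
noncomputable section

namespace FuzzyKMeans

/-! ### Parameters and the union bound -/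

variable {D : ℕ}

/-- The non-empty subsets of `Γ` with at most `K` elements. -/
def smallSubsets (K : ℕ) (Γ : Finset (Pt D)) : Finset (Finset (Pt D)) :=
  Γ.powerset.filter fun M => M.Nonempty ∧ M.card ≤ K

theorem mem_smallSubsets {K : ℕ} {Γ M : Finset (Pt D)} :
    M ∈ smallSubsets K Γ ↔ M ⊆ Γ ∧ M.Nonempty ∧ M.card ≤ K := by
  simp [smallSubsets]

/-- Every such subset is the image of some map `Fin K → Γ`, repetitions allowed. -/
theorem card_smallSubsets_le (K : ℕ) (Γ : Finset (Pt D)) :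
    (smallSubsets K Γ).card ≤ Γ.card ^ K := by
  have hsub : smallSubsets K Γ ⊆ (Finset.univ : Finset (Fin K → ↥Γ)).image
      fun g => Finset.univ.image fun i => (g i : Pt D) := by
    intro M hM
    obtain ⟨hMΓ, ⟨y, hy⟩, hK⟩ := mem_smallSubsets.1 hM
    obtain ⟨e⟩ : Nonempty (↥M ↪ Fin K) := Function.Embedding.nonempty_of_card_le (by simpa)
    have : Nonempty ↥M := ⟨⟨y, hy⟩⟩
    refine Finset.mem_image.2
      ⟨fun i => ⟨(Function.invFun e i : ↥M), hMΓ (Function.invFun e i).2⟩, Finset.mem_univ _, ?_⟩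
    ext x
    simp only [Finset.mem_image, Finset.mem_univ, true_and]
    constructor
    · rintro ⟨i, rfl⟩
      exact (Function.invFun e i).2
    · intro hx
      exact ⟨e ⟨x, hx⟩, by rw [Function.leftInverse_invFun e.injective]⟩
  refine (Finset.card_le_card hsub).trans (Finset.card_image_le.trans ?_)
  simp

theorem four_le_log_argument {β δ : ℝ} {K γ F : ℕ} (hK : 1 ≤ K) (hγ : 1 ≤ γ) (hβ : 1 ≤ β)
    (hδ : δ ∈ Set.Ioo (0 : ℝ) 1) (hF : 1 ≤ F) : 4 ≤ 4 * β * K * F * (γ : ℝ) ^ K / δ := by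
  have hK' : (1 : ℝ) ≤ K := by exact_mod_cast hK
  have hγ' : (1 : ℝ) ≤ (γ : ℝ) ^ K := one_le_pow₀ (by exact_mod_cast hγ)
  have hF' : (1 : ℝ) ≤ F := by exact_mod_cast hF
  rw [le_div_iff₀ hδ.1]
  have h1 : 1 ≤ β * K * F * (γ : ℝ) ^ K :=
    one_le_mul_of_one_le_of_one_le
      (one_le_mul_of_one_le_of_one_le (one_le_mul_of_one_le_of_one_le hβ hK') hF') hγ'
  nlinarith [hδ.2]

/-- The deviation, relative to the range, that is allowed within a cell. -/
def tolerance (m α ε : ℝ) (K : ℕ) : ℝ := ε / (34 * α * (K : ℝ) ^ (m - 1))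

/-- The factors `α K^(m-1) / ε` cancel against the tolerance and leave `qc / 34²`; this is where
`1156 = 34²` comes from. -/
theorem log_le_sampleSize_mul_sq {qc m α β ε δ : ℝ} {K γ F : ℕ} (hqc : 1156 ≤ qc) (hK : 1 ≤ K)
    (hγ : 1 ≤ γ) (hα : 1 ≤ α) (hβ : 1 ≤ β) (hε : 0 < ε) (hδ : δ ∈ Set.Ioo (0 : ℝ) 1)
    (hF : 1 ≤ F) : Real.log (4 * β * K * F * (γ : ℝ) ^ K / δ) ≤
      sampleSize qc m α β ε δ K γ F * tolerance m α ε K ^ 2 := by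
  have hL : 0 ≤ Real.log (4 * β * K * F * (γ : ℝ) ^ K / δ) :=
    Real.log_nonneg (by linarith [four_le_log_argument hK hγ hβ hδ hF])
  have hKp : 0 < (K : ℝ) ^ (m - 1) := Real.rpow_pos_of_pos (by exact_mod_cast hK) _
  have h := Nat.le_ceil (qc * (α * (K : ℝ) ^ (m - 1) / ε) ^ 2 *
    Real.log (4 * β * K * F * (γ : ℝ) ^ K / δ))
  refine le_trans ?_ (mul_le_mul_of_nonneg_right h (sq_nonneg _))
  have e : qc * (α * (K : ℝ) ^ (m - 1) / ε) ^ 2 *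
      Real.log (4 * β * K * F * (γ : ℝ) ^ K / δ) * tolerance m α ε K ^ 2 =
      qc / 1156 * Real.log (4 * β * K * F * (γ : ℝ) ^ K / δ) := by
    have : 0 < α := by linarith
    unfold tolerance
    field_simp
    norm_num
  rw [e]
  exact le_mul_of_one_le_left hL (by rw [le_div_iff₀] <;> linarith)

theorem sampleSize_pos {qc m α β ε δ : ℝ} {K γ F : ℕ} (hqc : 1156 ≤ qc) (hK : 1 ≤ K)
    (hγ : 1 ≤ γ) (hα : 1 ≤ α) (hβ : 1 ≤ β) (hε : 0 < ε) (hδ : δ ∈ Set.Ioo (0 : ℝ) 1)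
    (hF : 1 ≤ F) : 0 < sampleSize qc m α β ε δ K γ F := by
  have hL : 0 < Real.log (4 * β * K * F * (γ : ℝ) ^ K / δ) :=
    Real.log_pos (by linarith [four_le_log_argument hK hγ hβ hδ hF])
  have hKp : 0 < (K : ℝ) ^ (m - 1) := Real.rpow_pos_of_pos (by exact_mod_cast hK) _
  have : 0 < α := by linarith
  exact Nat.ceil_pos.2 (by positivity)

/-- With `Z` the argument of the logarithm, each event fails with probability at most `2 / Z²`, and
there are at most `2γ^K * 2βKF = Zδ` of them. The total `2δ / Z` is at most `δ`, as `Z ≥ 4`. -/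
theorem failure_probability_le {qc m α β ε δ t : ℝ} {K γ F : ℕ} {A : Finset (Pt D)}
    (hqc : 1156 ≤ qc) (hK : 1 ≤ K) (hγ : 1 ≤ γ) (hα : 1 ≤ α) (hβ : 1 ≤ β) (hε : 0 < ε)
    (hδ : δ ∈ Set.Ioo (0 : ℝ) 1) (hF : 1 ≤ F) (hA : (A.card : ℝ) ≤ β * K)
    (ht : t ≤ 2 * (γ : ℝ) ^ K) :
    t * (cellIndices A F).card *
      (2 * Real.exp (-(2 * sampleSize qc m α β ε δ K γ F * tolerance m α ε K ^ 2))) ≤ δ := by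
  have hq := log_le_sampleSize_mul_sq (m := m) hqc hK hγ hα hβ hε hδ hF
  have hZ := four_le_log_argument hK hγ hβ hδ hF
  have hF' : (1 : ℝ) ≤ F := by exact_mod_cast hF
  set Z := 4 * β * K * F * (γ : ℝ) ^ K / δ with hZdef
  have hexp : Real.exp (-(2 * sampleSize qc m α β ε δ K γ F * tolerance m α ε K ^ 2)) ≤
      1 / Z ^ 2 := by
    rw [one_div, ← Real.exp_log (show 0 < Z by linarith), ← Real.exp_nat_mul, ← Real.exp_neg,
      Real.exp_le_exp]
    push_cast
    linarith
  -- There are `F + 1 ≤ 2F` rings per centre, because `F ≥ 1`.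
  have hJ : ((cellIndices A F).card : ℝ) ≤ β * K * (2 * F) := by
    rw [cellIndices, Finset.card_product, Finset.card_range]
    push_cast
    exact mul_le_mul hA (by linarith) (by positivity) (by positivity)
  calc _ ≤ 2 * (γ : ℝ) ^ K * (β * K * (2 * F)) * (2 * (1 / Z ^ 2)) := by
        gcongr
    _ = 2 * δ / Z := by
        have h0 : Z * δ = 4 * β * K * F * (γ : ℝ) ^ K := div_mul_cancel₀ _ hδ.1.ne'
        have : 2 * (γ : ℝ) ^ K * (β * K * (2 * F)) = Z * δ := by rw [h0]; ring
        rw [this]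
        field_simp
    _ ≤ δ := by
        rw [div_le_iff₀ (by linarith)]
        nlinarith [hδ.1]

/-! ### The algorithm and its variant -/

/-- The cost of a point with the means `M`: the fuzzy cost or the `K`-means cost. -/
def modeCost (m : ℝ) (t : Finset (Pt D) × Bool) (x : Pt D) : ℝ :=
  if t.2 then pointCost m t.1 x else Metric.infDist x (t.1 : Set (Pt D)) ^ 2

theorem preservesCosts_of_abs_sub_le {m ε : ℝ} (hm : 1 < m) (hε : 0 ≤ ε) {K : ℕ} (hK : 1 ≤ K)
    {X Γ S : Finset (Pt D)} {w : Pt D → ℝ} (hw : ∀ x, 0 ≤ w x)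
    (h : ∀ t ∈ smallSubsets K Γ ×ˢ (Finset.univ : Finset Bool),
      |∑ s ∈ S, w s * modeCost m t s - ∑ x ∈ X, modeCost m t x| ≤
        ε / (K : ℝ) ^ (m - 1) * kmeansCost X 1 t.1) :
    PreservesCosts m ε K X Γ S w := by
  intro M hMΓ hM hMK
  have hKp : 0 < (K : ℝ) ^ (m - 1) := Real.rpow_pos_of_pos (by exact_mod_cast hK) _
  have hmem := mem_smallSubsets.2 ⟨hMΓ, hM, hMK⟩
  have h1 := abs_le.1 (h (M, true) (by simp [hmem]))
  have h2 := abs_le.1 (h (M, false) (by simp [hmem]))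
  simp only [modeCost, if_true, Bool.false_eq_true, if_false] at h1 h2
  -- Passing from `K`-means to fuzzy cost loses exactly the factor `K^(m-1)` put into the additive
  -- error.
  have h3 : ε / (K : ℝ) ^ (m - 1) * kmeansCost X 1 M ≤ ε * fuzzyCost m X 1 M := by
    rw [div_mul_eq_mul_div, div_le_iff₀ hKp]
    nlinarith [mul_le_mul_of_nonneg_left (kmeansCost_le_fuzzyCost hm hM hMK X) hε]
  have e1 : fuzzyCost m X 1 M = ∑ x ∈ X, pointCost m M x := by
    rw [fuzzyCost_eq_sum hm hM X 1 fun _ => zero_le_one]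
    simp
  have e2 : kmeansCost X 1 M = ∑ x ∈ X, Metric.infDist x (M : Set (Pt D)) ^ 2 := by
    simp [kmeansCost]
  rw [← e1, ← fuzzyCost_eq_sum hm hM S w hw] at h1
  rw [← e2, ← kmeansCost] at h2
  exact ⟨⟨by linarith, by linarith⟩, ⟨by linarith, by linarith⟩⟩

/-- If the draws are made from subsets `P p` of the cells and all the other points are kept with
weight `1`, then all costs are preserved with high probability. -/
theorem one_sub_le_sampleLaw_real_preservesCosts {qc m α β ε δ : ℝ} {K γ : ℕ}
    {X A Γ : Finset (Pt D)} {c : Pt D → Pt D} (hqc : 1156 ≤ qc) (hK : 1 ≤ K) (hγ : 1 ≤ γ)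
    (hm : 1 < m) (hα : 1 ≤ α) (hβ : 1 ≤ β) (hε : 0 < ε) (hδ : δ ∈ Set.Ioo (0 : ℝ) 1)
    (hαN : 1 < α * (X.card : ℝ)) (hA : IsBicriteria α β K X A) (hc : IsClosestAssignment X A c)
    (hΓ : Γ.card ≤ γ) (P : Pt D × ℕ → Finset (Pt D))
    (hP : ∀ p ∈ cellIndices A (ringCount α X.card), P p ⊆ cell X c (baseRadius α X A) p)
    (S : Sample (cellIndices A (ringCount α X.card)) P
      (sampleSize qc m α β ε δ K γ (ringCount α X.card)) → Finset (Pt D))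
    (w : Sample (cellIndices A (ringCount α X.card)) P
      (sampleSize qc m α β ε δ K γ (ringCount α X.card)) → Pt D → ℝ)
    (hw : ∀ ω x, 0 ≤ w ω x)
    (hS : ∀ ω f, ∑ s ∈ S ω, w ω s * f s = drawSum ω f +
      ∑ p ∈ cellIndices A (ringCount α X.card),
        ∑ x ∈ cell X c (baseRadius α X A) p \ P p, f x) :
    1 - δ ≤ (sampleLaw (cellIndices A (ringCount α X.card)) P
      (sampleSize qc m α β ε δ K γ (ringCount α X.card))).real
        {ω | PreservesCosts m ε K X Γ (S ω) (w ω)} := by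
  have hF := one_le_ringCount hαN
  have hq := sampleSize_pos (m := m) hqc hK hγ hα hβ hε hδ hF
  have hKp : 0 < (K : ℝ) ^ (m - 1) := Real.rpow_pos_of_pos (by exact_mod_cast hK) _
  have hα0 : 0 < α := by linarith
  have hl : 0 ≤ tolerance m α ε K := by
    unfold tolerance
    positivity
  have hcard : ((smallSubsets K Γ ×ˢ (Finset.univ : Finset Bool)).card : ℝ) ≤
      2 * (γ : ℝ) ^ K := by
    have h := (card_smallSubsets_le K Γ).trans (Nat.pow_le_pow_left hΓ K)
    rw [Finset.card_product, Finset.card_univ, Fintype.card_bool, mul_comm]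
    exact_mod_cast Nat.mul_le_mul_left 2 h
  refine (one_sub_le_sampleLaw_real hq (smallSubsets K Γ ×ˢ (Finset.univ : Finset Bool))
    (modeCost m) (fun t => cellBound (baseRadius α X A) t.1) hl ?_
    (failure_probability_le hqc hK hγ hα hβ hε hδ hF hA.2.1 hcard)).trans
    (MeasureTheory.measureReal_mono fun ω hω => ?_)
  · intro t ht p hp x hx
    have hM := (mem_smallSubsets.1 (Finset.mem_product.1 ht).1).2.1
    have hB := infDist_sq_le_cellBound (hP p hp hx) t.1
    unfold modeCost
    split_ifs
    · exact ⟨pointCost_nonneg hm hM x, (pointCost_le_infDist_sq hm hM x).trans hB⟩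
    · exact ⟨sq_nonneg _, hB⟩
  · refine preservesCosts_of_abs_sub_le hm hε.le hK (hw ω) fun t ht => ?_
    obtain ⟨-, hM, hMK⟩ := mem_smallSubsets.1 (Finset.mem_product.1 ht).1
    -- The points outside the parts `P p` enter both sums with weight `1` and cancel.
    rw [hS, ← sum_cells hαN hc, ← sum_parts_add_sum_sdiff hP, add_sub_add_right_eq_sub]
    refine (hω t ht).trans ?_
    calc _ ≤ tolerance m α ε K * (34 * α * kmeansCost X 1 t.1) := by
          refine mul_le_mul_of_nonneg_left (le_trans (Finset.sum_le_sum fun p hp => ?_)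
            (sum_card_mul_cellBound_le hα hαN hA hc hM hMK)) hl
          exact mul_le_mul_of_nonneg_right
            (by exact_mod_cast Finset.card_le_card (hP p hp)) (cellBound_nonneg _ _ _)
      _ = _ := by
          unfold tolerance
          field_simp

end FuzzyKMeans
end
-- Both algorithms as instances of one sampling scheme
theorem mainTheorem4 :
    ∃ q₀ : ℝ, 0 < q₀ ∧ ∀ qc : ℝ, q₀ ≤ qc →
    ∀ (D K γ : ℕ) (m α β ε δ : ℝ) (X A Γ : Finset (FuzzyKMeans.Pt D))
      (c : FuzzyKMeans.Pt D → FuzzyKMeans.Pt D),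
    1 ≤ K → 1 ≤ γ → 1 < m → 1 ≤ α → 1 ≤ β → ε ∈ Set.Ioo (0 : ℝ) 1 → δ ∈ Set.Ioo (0 : ℝ) 1 →
    1 < α * (X.card : ℝ) →
    FuzzyKMeans.IsBicriteria α β K X A →
    FuzzyKMeans.IsClosestAssignment X A c →
    Γ.card ≤ γ →
    ∀ (F : ℕ) (R : ℝ) (q : ℕ),
    F = FuzzyKMeans.ringCount α X.card →
    R = FuzzyKMeans.baseRadius α X A →
    q = FuzzyKMeans.sampleSize qc m α β ε δ K γ F →
    -- the algorithm as it stands, with rational weights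
    ((∀ ω : FuzzyKMeans.Sample (FuzzyKMeans.cellIndices A F) (FuzzyKMeans.cell X c R) q,
        FuzzyKMeans.sampledSet ω ⊆ X ∧
        (∀ s ∈ FuzzyKMeans.sampledSet ω, 0 < FuzzyKMeans.sampledWeight ω s) ∧
        ∑ s ∈ FuzzyKMeans.sampledSet ω, FuzzyKMeans.sampledWeight ω s = X.card) ∧
      1 - δ ≤ (FuzzyKMeans.sampleLaw (FuzzyKMeans.cellIndices A F) (FuzzyKMeans.cell X c R) q).real
        {ω | FuzzyKMeans.PreservesCosts m ε K X Γ (FuzzyKMeans.sampledSet ω)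
          (FuzzyKMeans.sampledWeight ω)}) ∧
    -- its variant with natural numbers as weights
    (∀ P : FuzzyKMeans.Pt D × ℕ → Finset (FuzzyKMeans.Pt D),
      FuzzyKMeans.IsDivisiblePart (FuzzyKMeans.cellIndices A F) (FuzzyKMeans.cell X c R) P q →
      (∀ ω : FuzzyKMeans.Sample (FuzzyKMeans.cellIndices A F) P q,
        FuzzyKMeans.integerSet (FuzzyKMeans.cell X c R) ω ⊆ X ∧
        (∀ s ∈ FuzzyKMeans.integerSet (FuzzyKMeans.cell X c R) ω, 0 < FuzzyKMeans.integerWeight (FuzzyKMeans.cell X c R) ω s) ∧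
        ∑ s ∈ FuzzyKMeans.integerSet (FuzzyKMeans.cell X c R) ω, FuzzyKMeans.integerWeight (FuzzyKMeans.cell X c R) ω s = X.card) ∧
      1 - δ ≤ (FuzzyKMeans.sampleLaw (FuzzyKMeans.cellIndices A F) P q).real
        {ω | FuzzyKMeans.PreservesCosts m ε K X Γ (FuzzyKMeans.integerSet (FuzzyKMeans.cell X c R) ω)
          (fun x => (FuzzyKMeans.integerWeight (FuzzyKMeans.cell X c R) ω x : ℝ))}) := by
  refine ⟨1156, by norm_num, ?_⟩
  intro qc hqc D K γ m α β ε δ X A Γ c hK hγ hm hα hβ hε hδ hαN hA hc hΓ F R q hF hR hq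
  subst hF hR hq
  have hq := FuzzyKMeans.sampleSize_pos (m := m) hqc hK hγ hα hβ hε.1 hδ
    (FuzzyKMeans.one_le_ringCount hαN)
  have hcell : ∀ p, FuzzyKMeans.cell X c (FuzzyKMeans.baseRadius α X A) p ⊆ X :=
    fun p => Finset.filter_subset _ _
  have hN : ∑ p ∈ FuzzyKMeans.cellIndices A (FuzzyKMeans.ringCount α X.card),
      ∑ _x ∈ FuzzyKMeans.cell X c (FuzzyKMeans.baseRadius α X A) p, (1 : ℝ) = X.card := by
    rw [FuzzyKMeans.sum_cells hαN hc]
    simp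
  refine ⟨⟨fun ω => ⟨?_, ?_, ?_⟩, ?_⟩, fun P hP => ⟨fun ω => ⟨?_, ?_, ?_⟩, ?_⟩⟩
  · exact FuzzyKMeans.sampledSet_subset (fun p _ => hcell p) ω
  · exact fun s hs => FuzzyKMeans.sampledWeight_pos hq hs
  · rw [← hN, ← FuzzyKMeans.drawSum_one hq ω,
      ← FuzzyKMeans.sum_sampledWeight_mul ω Finset.Subset.rfl]
    simp
  -- The plain algorithm is the case where `P` is the whole cell and nothing is set aside.
  · refine FuzzyKMeans.one_sub_le_sampleLaw_real_preservesCosts hqc hK hγ hm hα hβ hε.1 hδ hαN hA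
      hc hΓ _ (fun _ _ => Finset.Subset.rfl) _ _ FuzzyKMeans.sampledWeight_nonneg fun ω f => ?_
    simp [FuzzyKMeans.sum_sampledWeight_mul ω Finset.Subset.rfl]
  · refine Finset.union_subset
      (FuzzyKMeans.sampledSet_subset (fun p hp => (hP p hp).1.trans (hcell p)) ω) ?_
    exact Finset.biUnion_subset.2 fun p _ => Finset.sdiff_subset.trans (hcell p)
  · exact fun s hs => FuzzyKMeans.integerWeight_pos hq hP hs
  · have h := FuzzyKMeans.sum_integerWeight_mul hq hP
      (fun p p' hne => FuzzyKMeans.disjoint_cell (FuzzyKMeans.baseRadius_nonneg α X A) hne) ω fun _ => 1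
    rw [FuzzyKMeans.drawSum_one hq ω,
      FuzzyKMeans.sum_parts_add_sum_sdiff fun p hp => (hP p hp).1, hN] at h
    simp only [mul_one] at h
    exact_mod_cast h
  · exact FuzzyKMeans.one_sub_le_sampleLaw_real_preservesCosts hqc hK hγ hm hα hβ hε.1 hδ hαN hA
      hc hΓ P (fun p hp => (hP p hp).1) _ _ (fun _ _ => Nat.cast_nonneg _)
      (FuzzyKMeans.sum_integerWeight_mul hq hP
        fun p p' hne => FuzzyKMeans.disjoint_cell (FuzzyKMeans.baseRadius_nonneg α X A) hne)
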